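/- Let $w,a\ge 0$ be integers and put $n=2w+a$. The vertices of the Johnson graph $J(n,w)$ are the $w$-subsets of a fixed $n$-set, two of them being adjacent if and only if they meet in exactly $w-1$ points. A set $C$ of vertices is a $1$-perfect code if every vertex is at graph distance at most $1$ from exactly one element of $C$. The trivial perfect codes are the set of all vertices, a single $w$-subset and, if $n=2w$ with $w$ odd, a pair of disjoint $w$-subsets. The code $C$ is a $t$-design ($0\le t\le w<n$) if there is an integer $\lambda>0$ such that every $t$-subset of the $n$-set is contained in exactly $\lambda$ elements of $C$, and the strength of $C$ is the largest $t$ for which $C$ is a $t$-design. Suppose that $C$ is a nontrivial $1$-perfect code in $J(2w+a,w)$ with strength $w-d$, where $0\le d\le w$. Then $d>1$; $d\equiv 0$ or $1\pmod 3$; $w-d\equiv 0,1,4$ or $9\pmod{12}$; $$a=\frac{w-d^{2}+d-1}{d-1};$$ and $$\frac{\prod_{i=0}^{d-2}\bigl(wd-(d+i(d-1))\bigr)}{(d-1)!\,(d-1)^{d-1}\,d\,(w-d+1)}\in\mathbb{Z}.$$ -/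

import Mathlib

/-- The Johnson space: all `w`-subsets of a fixed `n`-set. -/
abbrev JohnsonSpace (n w : ℕ) : Type := {s : Finset (Fin n) // s.card = w}

/-- The Johnson graph `J(n, w)`: two `w`-subsets are adjacent if and only if they meet in
exactly `w - 1` points. -/
def johnsonGraph (n w : ℕ) : SimpleGraph (JohnsonSpace n w) where
  Adj u v := (u.1 ∩ v.1).card + 1 = w
  symm := ⟨fun u v h => by rw [Finset.inter_comm]; exact h⟩
  loopless := ⟨fun u h => by rw [Finset.inter_self, u.2] at h; omega⟩

/-- `C` is an `e`-perfect code in `J(n, w)`: every vertex is within graph distance `e` of a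
unique codeword. -/
def IsPerfectCode {n w : ℕ} (e : ℕ) (C : Set (JohnsonSpace n w)) : Prop :=
  ∀ v : JohnsonSpace n w, ∃! c : JohnsonSpace n w, c ∈ C ∧ (johnsonGraph n w).edist v c ≤ e

/-- The trivial perfect codes in `J(n, w)`: the whole space, a single `w`-subset (where
`w ≤ n - w`), and, if `n = 2w` with `w` odd, a pair of disjoint `w`-subsets. -/
def IsTrivialCode {n w : ℕ} (C : Set (JohnsonSpace n w)) : Prop :=
  C = Set.univ ∨
  (2 * w ≤ n ∧ ∃ v, C = {v}) ∨
  (n = 2 * w ∧ Odd w ∧ ∃ u v : JohnsonSpace n w, Disjoint u.1 v.1 ∧ C = {u, v})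

/-- `C` is a `t-(n, w, l)` design: `n > w ≥ t`, `l > 0`, and every `t`-subset of the `n`-set is
contained in exactly `l` blocks of `C`. -/
def IsBlockDesign {n w : ℕ} (t l : ℕ) (C : Set (JohnsonSpace n w)) : Prop :=
  w < n ∧ t ≤ w ∧ 0 < l ∧
    ∀ T : Finset (Fin n), T.card = t → {c : JohnsonSpace n w | c ∈ C ∧ T ⊆ c.1}.ncard = l

/-- `C` has strength `φ`: `φ` is the largest `t` for which `C` is a `t`-design. -/
def HasStrength {n w : ℕ} (C : Set (JohnsonSpace n w)) (φ : ℕ) : Prop :=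
  IsGreatest {t : ℕ | ∃ l : ℕ, IsBlockDesign t l C} φ

/-!
Write `N = w + a` for the size of the complement of a codeword.

*The formula for `a` and the integrality condition.* Count the `w`-sets containing a set `T` of
size `i + 1` by the codewords covering them. If the code is an `i`-design, this gives a linear
equation for the number of codewords containing `T`, with the leading coefficient
`(w - i - 1) * (N - i - 1) - i`, an eigenvalue of the Johnson graph plus one
(`IsPerfectFamily.eigenvalue_mul_degree`). If it does not vanish, the code is an
`(i + 1)`-design. So for `i = w - d` the maximality in the definition of strength forces
`(d - 1) * (a + d - 1) = w - d` (`HasStrength.eigenvalue_eq_zero`). With `k = d - 1` and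
`m = a + k` this reads `w - d = k * m`, `w = k * (m + 1) + 1`, `N = (k + 1) * m + 1`, and a ball
has `(k * m + 1) * ((k + 1) * (m + 1) + 1)` elements. The quotient in the last claim is then the
number of codewords containing a fixed `(w - d)`-set (`prod_div_eq_of_degree`).

*The congruences.* Look at the code from a codeword `X` with complement `Y`, and encode the
vertex `(X \ A) ∪ B` by `(A, B)` (`IsLocalCode`). The vertices at distance `2` are covered by
codewords at distance `3`, so for each pair `Q ⊆ Y` the sets `A` of the codewords `(A, B)` at
distance `3` with `Q ⊆ B` form a Steiner triple system on `X`. Hence `w` is odd and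
`w % 3 ≠ 2`, and likewise for `N`. The vertices at distance `3` are covered by codewords at
distance `3` or `4`, which gives two further facts.

* Count the vertices `(A, B)` at distance `3` with `Q ⊆ B`. A codeword at distance `4` covers
  `0` or `8` of them, and the number of those covered from distance `3` is determined by the
  Steiner systems. Modulo `8` this excludes `w ≡ 3`, `N ≡ 1` modulo `4`
  (`IsLocalCode.mod_four`), and by symmetry the case with `w` and `N` exchanged.
* Fix a triple `B` and a point `u ∈ X`, and count the vertices `(A, B)` with `u ∈ A` modulo `3`.
  If `3 ∣ w`, there must be a codeword `(A, B)` with `u ∈ A`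
  (`IsLocalCode.three_dvd_choose`). As this holds for every `B` containing a fixed pair,
  `2 * (N - 2) ≤ w - 1`, whence `w = N = 3`, and the code is trivial.

These conditions on `k * (m + 1) + 1` and `(k + 1) * m + 1` modulo `3` and `4` give the stated
congruences for `d = k + 1` and `w - d = k * m`.
-/

open Finset

/-! ### Exchanging one element of a finite set -/

section Exchange

variable {α : Type*} [DecidableEq α]

lemma filter_card_inter_add_one_eq_image {c U : Finset α} (hc : c ⊆ U) :
    {v ∈ U.powersetCard #c | #(v ∩ c) + 1 = #c} =
      (c ×ˢ (U \ c)).image fun q => insert q.2 (c.erase q.1) := by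
  ext v
  simp only [mem_filter, mem_powersetCard, mem_image, mem_product, mem_sdiff, Prod.exists]
  constructor
  · rintro ⟨⟨hvU, hv⟩, h⟩
    have h1 := card_sdiff_add_card_inter c v
    have h2 := card_sdiff_add_card_inter v c
    rw [inter_comm] at h1
    obtain ⟨x, hx⟩ := card_eq_one.1 (show #(c \ v) = 1 by omega)
    obtain ⟨y, hy⟩ := card_eq_one.1 (show #(v \ c) = 1 by omega)
    have hx' : ∀ z, z ∈ c ∧ z ∉ v ↔ z = x := fun z => by rw [← mem_sdiff, hx, mem_singleton]
    have hy' : ∀ z, z ∈ v ∧ z ∉ c ↔ z = y := fun z => by rw [← mem_sdiff, hy, mem_singleton]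
    have hxc := (hx' x).2 rfl
    have hyv := (hy' y).2 rfl
    refine ⟨x, y, ⟨hxc.1, hvU hyv.1, hyv.2⟩, ?_⟩
    ext z
    have := hx' z
    have := hy' z
    simp only [mem_insert, mem_erase]
    by_cases hzx : z = x <;> by_cases hzy : z = y <;> grind
  · rintro ⟨x, y, ⟨hx, hyU, hy⟩, rfl⟩
    have hy' : y ∉ c.erase x := fun h => hy (mem_of_mem_erase h)
    have hpos : 0 < #c := card_pos.2 ⟨x, hx⟩
    refine ⟨⟨insert_subset hyU ((erase_subset _ _).trans hc), ?_⟩, ?_⟩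
    · rw [card_insert_of_notMem hy', card_erase_of_mem hx]; omega
    · rw [insert_inter_of_notMem hy, inter_eq_left.2 (erase_subset _ _), card_erase_of_mem hx]
      omega

lemma injOn_insert_erase (c U : Finset α) :
    Set.InjOn (fun q : α × α => insert q.2 (c.erase q.1)) (c ×ˢ (U \ c) : Finset (α × α)) := by
  rintro ⟨x, y⟩ h ⟨x', y'⟩ h' heq
  simp only [coe_product, Set.mem_prod, mem_coe, mem_sdiff] at h h'
  have hz : ∀ z, z ∈ insert y (c.erase x) ↔ z ∈ insert y' (c.erase x') := fun z => by
    have : insert y (c.erase x) = insert y' (c.erase x') := heq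
    rw [this]
  simp only [mem_insert, mem_erase] at hz
  have := hz y
  have := hz x
  grind

lemma card_filter_exchange {c U : Finset α} (hc : c ⊆ U) (p : Finset α → Prop)
    [DecidablePred p] :
    #{v ∈ U.powersetCard #c | #(v ∩ c) + 1 = #c ∧ p v} =
      #{q ∈ c ×ˢ (U \ c) | p (insert q.2 (c.erase q.1))} := by
  rw [← filter_filter, filter_card_inter_add_one_eq_image hc, filter_image,
    card_image_of_injOn]
  exact (injOn_insert_erase c U).mono (coe_subset.2 (filter_subset _ _))

lemma card_filter_card_inter_add_one {c U : Finset α} (hc : c ⊆ U) :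
    #{v ∈ U.powersetCard #c | #(v ∩ c) + 1 = #c} = #c * (#U - #c) := by
  rw [filter_card_inter_add_one_eq_image hc, card_image_of_injOn (injOn_insert_erase c U),
    card_product, card_sdiff_of_subset hc]

end Exchange

/-! ### Double counting in a perfect code -/

section Cover

variable {β γ : Type*}

/-- Double counting over a set `F` whose points are each covered by a unique member of `D`. -/
lemma card_eq_sum_card_of_existsUnique (F : Finset β) (D : Finset γ) (r : β → γ → Prop)
    [∀ v b, Decidable (r v b)] (h : ∀ v ∈ F, ∃! b, b ∈ D ∧ r v b) :
    #F = ∑ b ∈ D, #{v ∈ F | r v b} := by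
  have h1 := sum_card_bipartiteAbove_eq_sum_card_bipartiteBelow (s := F) (t := D) r
  simp only [bipartiteAbove, bipartiteBelow] at h1
  rw [← h1, card_eq_sum_ones]
  refine sum_congr rfl fun v hv => ?_
  obtain ⟨b, hb, hu⟩ := h v hv
  symm
  rw [card_eq_one]
  refine ⟨b, ?_⟩
  ext b'
  rw [mem_filter, mem_singleton]
  exact ⟨fun h' => hu b' h', fun h' => h' ▸ hb⟩

end Cover

/-- A `1`-perfect code, presented as a family `𝒞` of `w`-element subsets of `α` such that every
`w`-subset meets exactly one member of `𝒞` in at least `w - 1` points. -/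
structure IsPerfectFamily {α : Type*} [DecidableEq α] (w : ℕ) (𝒞 : Finset (Finset α)) :
    Prop where
  card_eq : ∀ c ∈ 𝒞, #c = w
  existsUnique : ∀ v : Finset α, #v = w → ∃! c, c ∈ 𝒞 ∧ w ≤ #(v ∩ c) + 1

/-- The number of members of `𝒞` that contain `T`. -/
def degree {α : Type*} [DecidableEq α] (𝒞 : Finset (Finset α)) (T : Finset α) : ℕ :=
  #{c ∈ 𝒞 | T ⊆ c}

section Ball

variable {α : Type*} [DecidableEq α] [Fintype α]

lemma card_superset_ball_of_subset {T c : Finset α} (hT : T ⊆ c) :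
    #{v ∈ powersetCard #c (univ : Finset α) | T ⊆ v ∧ #c ≤ #(v ∩ c) + 1} =
      1 + (#c - #T) * (Fintype.card α - #c) := by
  have hsplit : {v ∈ powersetCard #c (univ : Finset α) | T ⊆ v ∧ #c ≤ #(v ∩ c) + 1} =
      insert c {v ∈ powersetCard #c (univ : Finset α) | #(v ∩ c) + 1 = #c ∧ T ⊆ v} := by
    ext v
    simp only [mem_filter, mem_insert, mem_powersetCard_univ]
    constructor
    · rintro ⟨hv, hTv, h⟩
      have h2 : #(v ∩ c) ≤ #c := card_le_card inter_subset_right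
      rcases h2.eq_or_lt with h3 | h3
      · left
        have : v ∩ c = c := eq_of_subset_of_card_le inter_subset_right h3.ge
        exact (eq_of_subset_of_card_le (inter_eq_right.1 this) hv.le).symm
      · exact Or.inr ⟨hv, by omega, hTv⟩
    · rintro (rfl | ⟨hv, h, hTv⟩)
      · simp [hT]
      · exact ⟨hv, hTv, h.ge⟩
  have hprod : {q ∈ c ×ˢ ((univ : Finset α) \ c) | T ⊆ insert q.2 (c.erase q.1)} =
      (c \ T) ×ˢ (univ \ c) := by
    ext ⟨x, y⟩
    simp only [mem_filter, mem_product, mem_sdiff, mem_univ, true_and]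
    constructor
    · rintro ⟨⟨hx, hy⟩, h⟩
      refine ⟨⟨hx, fun hxT => ?_⟩, hy⟩
      have := h hxT
      simp only [mem_insert, mem_erase, ne_eq, not_true_eq_false, false_and, or_false] at this
      exact hy (this ▸ hx)
    · rintro ⟨⟨hx, hxT⟩, hy⟩
      exact ⟨⟨hx, hy⟩, fun z hz => mem_insert_of_mem
        (mem_erase.2 ⟨fun h => hxT (h ▸ hz), hT hz⟩)⟩
  rw [hsplit, card_insert_of_notMem (by simp), card_filter_exchange (subset_univ c), hprod,
    card_product, card_sdiff_of_subset hT, card_sdiff_of_subset (subset_univ c), card_univ]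
  ring

lemma card_superset_ball_of_not_subset {T c : Finset α} (hT : ¬ T ⊆ c) :
    #{v ∈ powersetCard #c (univ : Finset α) | T ⊆ v ∧ #c ≤ #(v ∩ c) + 1} =
      if #(T \ c) = 1 then #c + 1 - #T else 0 := by
  have hsplit : {v ∈ powersetCard #c (univ : Finset α) | T ⊆ v ∧ #c ≤ #(v ∩ c) + 1} =
      {v ∈ powersetCard #c (univ : Finset α) | #(v ∩ c) + 1 = #c ∧ T ⊆ v} := by
    ext v
    simp only [mem_filter, mem_powersetCard_univ, and_congr_right_iff]
    intro hv
    rw [and_comm]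
    refine and_congr_left fun hTv => ⟨fun h => ?_, fun h => h.ge⟩
    have h2 : #(v ∩ c) ≤ #c := card_le_card inter_subset_right
    rcases h2.eq_or_lt with h3 | h3
    · have : v ∩ c = v := eq_of_subset_of_card_le inter_subset_left (by omega)
      exact absurd (hTv.trans (inter_eq_left.1 this)) hT
    · omega
  rw [hsplit, card_filter_exchange (subset_univ c)]
  split_ifs with h
  · obtain ⟨y, hy⟩ := card_eq_one.1 h
    have hy' : ∀ z, z ∈ T ∧ z ∉ c ↔ z = y := fun z => by rw [← mem_sdiff, hy, mem_singleton]
    have hyT := (hy' y).2 rfl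
    have hprod : {q ∈ c ×ˢ ((univ : Finset α) \ c) | T ⊆ insert q.2 (c.erase q.1)} = (c \ T) ×ˢ {y} := by
      ext ⟨x, y₁⟩
      simp only [mem_filter, mem_product, mem_sdiff, mem_univ, true_and, mem_singleton]
      constructor
      · rintro ⟨⟨hx, hy₁⟩, hs⟩
        have e1 := hs hyT.1
        simp only [mem_insert, mem_erase, hyT.2, and_false, or_false] at e1
        refine ⟨⟨hx, fun hxT => ?_⟩, e1.symm⟩
        have e2 := hs hxT
        simp only [mem_insert, mem_erase, ne_eq, not_true_eq_false, false_and, or_false] at e2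
        exact hy₁ (e2 ▸ hx)
      · rintro ⟨⟨hx, hxT⟩, rfl⟩
        refine ⟨⟨hx, hyT.2⟩, fun z hz => ?_⟩
        rw [mem_insert, mem_erase]
        have := hy' z
        by_cases hzc : z ∈ c
        · exact Or.inr ⟨fun h => hxT (h ▸ hz), hzc⟩
        · exact Or.inl (this.1 ⟨hz, hzc⟩)
    rw [hprod, card_product, card_singleton, mul_one]
    have h1 := card_sdiff_add_card_inter c T
    have h2 := card_sdiff_add_card_inter T c
    rw [inter_comm] at h2
    omega
  · rw [card_eq_zero, filter_eq_empty_iff]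
    rintro ⟨x, y⟩ hq hs
    simp only [mem_product, mem_sdiff, mem_univ, true_and] at hq
    refine h (card_eq_one.2 ⟨y, ?_⟩)
    have hne : (T \ c).Nonempty := sdiff_nonempty.2 hT
    refine (subset_singleton_iff.1 fun z hz => ?_).resolve_left hne.ne_empty
    rw [mem_sdiff] at hz
    have := hs hz.1
    simp only [mem_insert, mem_erase, hz.2, and_false, or_false] at this
    exact mem_singleton.2 this

lemma card_filter_powersetCard_superset {T : Finset α} {w : ℕ} (hT : #T ≤ w) :
    #{v ∈ powersetCard w (univ : Finset α) | T ⊆ v} = (Fintype.card α - #T).choose (w - #T) := by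
  rw [← card_univ, ← card_sdiff_of_subset (subset_univ T), ← card_powersetCard]
  refine card_nbij' (fun v => v \ T) (fun v => v ∪ T) ?_ ?_ ?_ ?_
  · intro v hv
    simp only [mem_coe, mem_filter, mem_powersetCard_univ] at hv
    simp only [mem_coe, mem_powersetCard]
    exact ⟨sdiff_subset_sdiff (subset_univ _) le_rfl, by rw [card_sdiff_of_subset hv.2, hv.1]⟩
  · intro v hv
    simp only [mem_coe, mem_powersetCard] at hv
    simp only [mem_coe, mem_filter, mem_powersetCard_univ]
    refine ⟨?_, subset_union_right⟩
    rw [card_union_of_disjoint, hv.2]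
    · omega
    · exact disjoint_of_subset_left hv.1 sdiff_disjoint
  · intro v hv
    simp only [mem_coe, mem_filter, mem_powersetCard_univ] at hv
    exact sdiff_union_of_subset hv.2
  · intro v hv
    simp only [mem_coe, mem_powersetCard] at hv
    have : Disjoint v T := disjoint_of_subset_left hv.1 sdiff_disjoint
    simp [union_sdiff_distrib, this.sdiff_eq_left]

end Ball

/-! ### Degrees of point sets in a perfect code -/

section Degree

variable {α : Type*} [DecidableEq α]

lemma sum_degree_erase (𝒞 : Finset (Finset α)) (T : Finset α) :
    ∑ x ∈ T, degree 𝒞 (T.erase x) = #T * degree 𝒞 T + #{c ∈ 𝒞 | #(T \ c) = 1} := by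
  have h1 := sum_card_bipartiteAbove_eq_sum_card_bipartiteBelow (s := T) (t := 𝒞)
    fun x c => T.erase x ⊆ c
  simp only [bipartiteAbove, bipartiteBelow] at h1
  have h2 : ∀ c ∈ 𝒞, #{x ∈ T | T.erase x ⊆ c} =
      (if T ⊆ c then #T else 0) + if #(T \ c) = 1 then 1 else 0 := by
    intro c _
    by_cases hT : T ⊆ c
    · rw [if_pos hT, if_neg (by simp [sdiff_eq_empty_iff_subset.2 hT]), add_zero,
        filter_true_of_mem fun x _ => (erase_subset x T).trans hT]
    · rw [if_neg hT, zero_add]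
      have key : ∀ x ∈ T, T.erase x ⊆ c → T \ c = {x} := by
        intro x _ hx
        refine (subset_singleton_iff.1 fun z hz => ?_).resolve_left
          (sdiff_nonempty.2 hT).ne_empty
        rw [mem_sdiff] at hz
        by_contra hzx
        exact hz.2 (hx (mem_erase.2 ⟨fun h => hzx (mem_singleton.2 h), hz.1⟩))
      split_ifs with h
      · obtain ⟨y, hy⟩ := card_eq_one.1 h
        refine card_eq_one.2 ⟨y, ?_⟩
        ext x
        rw [mem_filter, mem_singleton]
        constructor
        · rintro ⟨hx, hs⟩
          have := key x hx hs
          rw [hy] at this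
          exact (singleton_injective this).symm
        · rintro rfl
          have hxT : x ∈ T \ c := hy ▸ mem_singleton_self x
          refine ⟨(mem_sdiff.1 hxT).1, fun z hz => ?_⟩
          by_contra hzc
          have : z ∈ T \ c := mem_sdiff.2 ⟨mem_of_mem_erase hz, hzc⟩
          rw [hy, mem_singleton] at this
          exact (mem_erase.1 hz).1 this
      · rw [card_eq_zero, filter_eq_empty_iff]
        intro x hx hs
        exact h (card_eq_one.2 ⟨x, key x hx hs⟩)
  simp only [degree]
  rw [h1, sum_congr rfl h2, sum_add_distrib, sum_ite, sum_const_zero, sum_const, card_filter,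
    card_filter, smul_eq_mul, add_zero, mul_comm]

lemma sum_degree_powersetCard [Fintype α] {𝒞 : Finset (Finset α)} {w : ℕ}
    (h𝒞 : ∀ c ∈ 𝒞, #c = w) (t : ℕ) :
    ∑ T ∈ powersetCard t univ, degree 𝒞 T = #𝒞 * w.choose t := by
  have h1 := sum_card_bipartiteAbove_eq_sum_card_bipartiteBelow
    (s := powersetCard t (univ : Finset α)) (t := 𝒞) fun T c => T ⊆ c
  simp only [bipartiteAbove, bipartiteBelow] at h1
  simp only [degree]
  rw [h1, sum_const_nat]
  intro c hc
  rw [← h𝒞 c hc, ← card_powersetCard]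
  congr 1
  ext T
  simp [mem_powersetCard, and_comm]

variable [Fintype α] {w : ℕ} {𝒞 : Finset (Finset α)}

/-- Every `w`-set containing `T` is covered once: by a codeword containing `T`, or by a codeword
that misses exactly one point of `T`. -/
lemma IsPerfectFamily.choose_eq (h : IsPerfectFamily w 𝒞) {T : Finset α} (hT : #T ≤ w) :
    (Fintype.card α - #T).choose (w - #T) =
      (1 + (w - #T) * (Fintype.card α - w)) * degree 𝒞 T +
        (w + 1 - #T) * #{c ∈ 𝒞 | #(T \ c) = 1} := by
  rw [← card_filter_powersetCard_superset hT,
    card_eq_sum_card_of_existsUnique _ 𝒞 (fun v c => w ≤ #(v ∩ c) + 1)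
      (fun v hv => h.existsUnique v (mem_powersetCard_univ.1 (mem_filter.1 hv).1))]
  have h2 : ∀ c ∈ 𝒞, #{v ∈ {v ∈ powersetCard w (univ : Finset α) | T ⊆ v} | w ≤ #(v ∩ c) + 1} =
      (if T ⊆ c then 1 + (w - #T) * (Fintype.card α - w) else 0) +
        if #(T \ c) = 1 then w + 1 - #T else 0 := by
    intro c hc
    obtain rfl := h.card_eq c hc
    rw [filter_filter]
    by_cases hTc : T ⊆ c
    · rw [if_pos hTc, if_neg (by simp [sdiff_eq_empty_iff_subset.2 hTc]), add_zero,
        card_superset_ball_of_subset hTc]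
    · rw [if_neg hTc, zero_add, card_superset_ball_of_not_subset hTc]
  rw [sum_congr rfl h2, sum_add_distrib, sum_ite, sum_ite]
  simp only [sum_const_zero, sum_const, smul_eq_mul, add_zero, degree]
  ring

/-- If all `i`-sets have the same degree, then the degree of an `(i+1)`-set is determined by a
linear equation, whose leading coefficient is an eigenvalue of the covering relation of the
Johnson graph. -/
lemma IsPerfectFamily.eigenvalue_mul_degree (h : IsPerfectFamily w 𝒞)
    (hw : w ≤ Fintype.card α) {i l : ℕ}
    (hi : i + 1 ≤ w) (hl : ∀ S : Finset α, #S = i → degree 𝒞 S = l) {T : Finset α}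
    (hT : #T = i + 1) :
    (((w : ℤ) - (i + 1)) * (Fintype.card α - w - (i + 1)) - i) * degree 𝒞 T =
      ((Fintype.card α - (i + 1)).choose (w - (i + 1)) : ℕ) - (w - i) * ((i + 1) * l) := by
  have h1 := h.choose_eq (T := T) (by omega)
  have h2 := sum_degree_erase 𝒞 T
  rw [sum_congr rfl fun x hx => hl (T.erase x) (by rw [card_erase_of_mem hx, hT]; omega),
    sum_const, smul_eq_mul, hT] at h2
  rw [hT] at h1
  rw [h1]
  have e1 : ((w - (i + 1) : ℕ) : ℤ) = w - (i + 1) := by push_cast [Nat.cast_sub hi]; ring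
  have e2 : ((w + 1 - (i + 1) : ℕ) : ℤ) = w - i := by
    rw [Nat.cast_sub (by omega)]; push_cast; ring
  rw [Nat.cast_add, Nat.cast_mul, Nat.cast_mul, e2]
  push_cast [e1, Nat.cast_sub hw]
  have h3 : ((i : ℤ) + 1) * l =
      (i + 1) * degree 𝒞 T + (#{c ∈ 𝒞 | #(T \ c) = 1} : ℕ) := by exact_mod_cast h2
  rw [h3]
  ring

lemma IsPerfectFamily.nonempty (h : IsPerfectFamily w 𝒞) (hw : w ≤ Fintype.card α) :
    𝒞.Nonempty := by
  rw [← card_univ] at hw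
  obtain ⟨v, -, hv⟩ := exists_subset_card_eq hw
  obtain ⟨c, ⟨hc, -⟩, -⟩ := h.existsUnique v hv
  exact ⟨c, hc⟩

/-- In a perfect code that is a `t`-design, the degree of a `t`-set times the size of a ball is
the number of all `w`-sets containing a `t`-set. -/
lemma IsPerfectFamily.degree_mul_ball (h : IsPerfectFamily w 𝒞) (hw : w ≤ Fintype.card α)
    {t l : ℕ} (ht : t ≤ w) (hl : ∀ S : Finset α, #S = t → degree 𝒞 S = l) :
    l * (1 + w * (Fintype.card α - w)) = (Fintype.card α - t).choose (w - t) := by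
  have h1 := sum_degree_powersetCard h.card_eq t
  rw [sum_congr rfl fun T hT => hl T (mem_powersetCard_univ.1 hT), sum_const,
    card_powersetCard, smul_eq_mul, card_univ] at h1
  have h2 := h.choose_eq (T := ∅) (by simp)
  simp only [card_empty, tsub_zero, degree, empty_subset, filter_true, empty_sdiff] at h2
  simp only [zero_ne_one, filter_false, card_empty, mul_zero, add_zero] at h2
  have h3 := Nat.choose_mul (n := Fintype.card α) ht
  have hpos : 0 < (Fintype.card α).choose t := Nat.choose_pos (ht.trans hw)
  refine Nat.eq_of_mul_eq_mul_left hpos ?_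
  rw [← h3, h2, ← mul_assoc, h1]
  ring

end Degree

/-! ### The strength of a perfect code -/

section Strength

variable {α : Type*} [DecidableEq α] [Fintype α] {w : ℕ} {𝒞 : Finset (Finset α)}

lemma IsPerfectFamily.exists_degree_eq_of_eigenvalue_ne_zero (h : IsPerfectFamily w 𝒞)
    (hw : w ≤ Fintype.card α) {i l : ℕ}
    (hi : i + 1 ≤ w) (hl : ∀ S : Finset α, #S = i → degree 𝒞 S = l)
    (hE : ((w : ℤ) - (i + 1)) * (Fintype.card α - w - (i + 1)) - i ≠ 0) :
    ∃ l', 0 < l' ∧ ∀ T : Finset α, #T = i + 1 → degree 𝒞 T = l' := by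
  obtain ⟨c, hc⟩ := h.nonempty hw
  obtain ⟨T₀, hT₀c, hT₀⟩ := exists_subset_card_eq (hi.trans (h.card_eq c hc).ge)
  refine ⟨degree 𝒞 T₀, card_pos.2 ⟨c, mem_filter.2 ⟨hc, hT₀c⟩⟩, fun T hT => ?_⟩
  have h1 := h.eigenvalue_mul_degree hw hi hl hT
  rw [← h.eigenvalue_mul_degree hw hi hl hT₀] at h1
  exact_mod_cast mul_left_cancel₀ hE h1

/-- The family of subsets of `Fin n` underlying a code in the Johnson graph. -/
noncomputable def codeFamily {n w : ℕ} (C : Set (JohnsonSpace n w)) : Finset (Finset (Fin n)) :=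
  open Classical in {c : JohnsonSpace n w | c ∈ C}.toFinset.map (Function.Embedding.subtype _)

lemma mem_codeFamily {n w : ℕ} {C : Set (JohnsonSpace n w)} {s : Finset (Fin n)} :
    s ∈ codeFamily C ↔ ∃ h : #s = w, (⟨s, h⟩ : JohnsonSpace n w) ∈ C := by
  simp [codeFamily]

lemma degree_codeFamily {n w : ℕ} (C : Set (JohnsonSpace n w)) (T : Finset (Fin n)) :
    degree (codeFamily C) T = {c : JohnsonSpace n w | c ∈ C ∧ T ⊆ c.1}.ncard := by
  classical
  rw [degree, Set.ncard_eq_toFinset_card']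
  symm
  refine card_bij (fun c _ => c.1) ?_ ?_ ?_
  · rintro ⟨c, hc⟩ h
    rw [Set.mem_toFinset] at h
    exact mem_filter.2 ⟨mem_codeFamily.2 ⟨hc, h.1⟩, h.2⟩
  · intro c _ c' _ h
    exact Subtype.ext h
  · intro c h
    obtain ⟨⟨hc, hC⟩, hT⟩ := (mem_filter.1 h).imp mem_codeFamily.1 id
    exact ⟨⟨c, hc⟩, Set.mem_toFinset.2 ⟨hC, hT⟩, rfl⟩

lemma johnsonGraph_edist_le_one {n w : ℕ} (v c : JohnsonSpace n w) :
    (johnsonGraph n w).edist v c ≤ (1 : ℕ) ↔ w ≤ #(v.1 ∩ c.1) + 1 := by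
  rw [Nat.cast_one, SimpleGraph.edist_le_one_iff_adj_or_eq]
  constructor
  · rintro (h | rfl)
    · exact (show #(v.1 ∩ c.1) + 1 = w from h).ge
    · rw [inter_self, v.2]
      omega
  · intro h
    have h1 : #(v.1 ∩ c.1) ≤ w := (card_le_card inter_subset_left).trans v.2.le
    rcases h1.eq_or_lt with h2 | h2
    · right
      have h3 : v.1 ∩ c.1 = v.1 := eq_of_subset_of_card_le inter_subset_left (by rw [h2, v.2])
      exact Subtype.ext (eq_of_subset_of_card_le (inter_eq_left.1 h3) (by rw [v.2, c.2]))
    · left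
      show #(v.1 ∩ c.1) + 1 = w
      omega

lemma IsPerfectCode.isPerfectFamily {n w : ℕ} {C : Set (JohnsonSpace n w)}
    (hC : IsPerfectCode 1 C) : IsPerfectFamily w (codeFamily C) where
  card_eq c hc := (mem_codeFamily.1 hc).1
  existsUnique v hv := by
    obtain ⟨c, ⟨hcC, hc⟩, hu⟩ := hC ⟨v, hv⟩
    refine ⟨c.1, ⟨mem_codeFamily.2 ⟨c.2, hcC⟩, (johnsonGraph_edist_le_one _ _).1 hc⟩, ?_⟩
    rintro s ⟨hs, hvs⟩
    obtain ⟨hsw, hsC⟩ := mem_codeFamily.1 hs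
    exact congrArg Subtype.val (hu ⟨s, hsw⟩ ⟨hsC, (johnsonGraph_edist_le_one _ _).2 hvs⟩)

/-- If `t < w` is the strength of a perfect code, then the eigenvalue belonging to `t + 1`
vanishes, since otherwise the code would be a `(t + 1)`-design. -/
lemma HasStrength.eigenvalue_eq_zero {n w t : ℕ} {C : Set (JohnsonSpace n w)}
    (hC : IsPerfectCode 1 C) (hs : HasStrength C t) (ht : t + 1 ≤ w) :
    ((w : ℤ) - (t + 1)) * (n - w - (t + 1)) - t = 0 := by
  obtain ⟨⟨l, hwn, -, -, hl⟩, hmax⟩ := hs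
  by_contra hE
  obtain ⟨l', hl'0, hl'⟩ := hC.isPerfectFamily.exists_degree_eq_of_eigenvalue_ne_zero
    (by simpa using hwn.le) ht (fun S hS => (degree_codeFamily C S).trans (hl S hS))
    (by simpa using hE)
  have : t + 1 ≤ t := hmax ⟨l', hwn, ht, hl'0, fun T hT =>
    (degree_codeFamily C T).symm.trans (hl' T hT)⟩
  omega

lemma IsBlockDesign.degree_mul_ball {n w t l : ℕ} {C : Set (JohnsonSpace n w)}
    (hC : IsPerfectCode 1 C) (h : IsBlockDesign t l C) :
    l * (1 + w * (n - w)) = (n - t).choose (w - t) := by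
  obtain ⟨hwn, htw, -, hl⟩ := h
  simpa using hC.isPerfectFamily.degree_mul_ball (by simpa using hwn.le) htw
    fun S hS => (degree_codeFamily C S).trans (hl S hS)

lemma IsBlockDesign.eq_univ {n w l : ℕ} {C : Set (JohnsonSpace n w)}
    (h : IsBlockDesign w l C) : C = Set.univ := by
  obtain ⟨-, -, hl0, hl⟩ := h
  refine Set.eq_univ_of_forall fun v => ?_
  have h1 := hl v.1 v.2
  obtain ⟨c, hc, hvc⟩ := Set.nonempty_of_ncard_ne_zero (h1.trans_ne hl0.ne')
  have : v = c := Subtype.ext (eq_of_subset_of_card_le hvc (by rw [v.2, c.2]))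
  exact this ▸ hc

end Strength

/-! ### The code as seen from a codeword -/

/-- A perfect code as seen from one of its codewords `X`, with complement `Y`: the vertex
`(X \ A) ∪ B` is encoded by the pair `(A, B)`, and `D` is the set of pairs encoding codewords.
The vertices encoded by `(A, B)` and `(A', B')` are at distance at most `1` if and only if
`#A + #A' ≤ #(A ∩ A') + #(B ∩ B') + 1`, whence the covering condition. -/
structure IsLocalCode {α : Type*} [DecidableEq α] (X Y : Finset α)
    (D : Finset (Finset α × Finset α)) : Prop where
  fst_subset : ∀ b ∈ D, b.1 ⊆ X
  snd_subset : ∀ b ∈ D, b.2 ⊆ Y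
  card_eq : ∀ b ∈ D, #b.1 = #b.2
  empty_mem : (∅, ∅) ∈ D
  existsUnique : ∀ A B, A ⊆ X → B ⊆ Y → #A = #B →
    ∃! b, b ∈ D ∧ #A + #b.1 ≤ #(A ∩ b.1) + #(B ∩ b.2) + 1

/-- The pairs of size `k` in `D`, that is, the codewords at distance `k` from the base point. -/
def layer {α : Type*} (D : Finset (Finset α × Finset α)) (k : ℕ) :
    Finset (Finset α × Finset α) :=
  {b ∈ D | #b.1 = k}

section Local

variable {α : Type*} [DecidableEq α]

lemma IsPerfectFamily.isLocalCode [Fintype α] {w : ℕ} {𝒞 : Finset (Finset α)}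
    (h : IsPerfectFamily w 𝒞) {c : Finset α} (hc : c ∈ 𝒞) :
    IsLocalCode c cᶜ (𝒞.image fun c' => (c \ c', c' \ c)) where
  fst_subset := by
    intro b hb
    obtain ⟨c', -, rfl⟩ := mem_image.1 hb
    exact sdiff_subset
  snd_subset := by
    intro b hb
    obtain ⟨c', -, rfl⟩ := mem_image.1 hb
    intro x hx
    exact mem_compl.2 (mem_sdiff.1 hx).2
  card_eq := by
    intro b hb
    obtain ⟨c', hc', rfl⟩ := mem_image.1 hb
    exact card_sdiff_comm ((h.card_eq c hc).trans (h.card_eq c' hc').symm)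
  empty_mem := mem_image.2 ⟨c, hc, by simp⟩
  existsUnique := by
    intro A B hA hB hAB
    have hBc : Disjoint B c := disjoint_left.2 fun x hx => mem_compl.1 (hB hx)
    have hAw := card_le_card hA
    have hcw := h.card_eq c hc
    have hv : #(c \ A ∪ B) = w := by
      rw [card_union_of_disjoint (disjoint_of_subset_left sdiff_subset hBc.symm),
        card_sdiff_of_subset hA]
      omega
    have key : ∀ c' ∈ 𝒞, w ≤ #((c \ A ∪ B) ∩ c') + 1 ↔
        #A + #(c \ c') ≤ #(A ∩ (c \ c')) + #(B ∩ (c' \ c)) + 1 := by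
      intro c' _
      have e1 : (c \ A ∪ B) ∩ c' = (c \ (A ∪ c \ c')) ∪ (B ∩ (c' \ c)) := by
        ext x
        have := @hA x
        have : x ∈ B → x ∉ c := fun hx => mem_compl.1 (hB hx)
        simp only [mem_inter, mem_union, mem_sdiff]
        tauto
      have hdisj : Disjoint (c \ (A ∪ c \ c')) (B ∩ (c' \ c)) :=
        disjoint_of_subset_left sdiff_subset (disjoint_of_subset_right inter_subset_left hBc.symm)
      have e3 : A ∪ c \ c' ⊆ c := union_subset hA sdiff_subset
      have e4 := card_union_add_card_inter A (c \ c')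
      have e5 := card_le_card e3
      rw [e1, card_union_of_disjoint hdisj, card_sdiff_of_subset e3]
      omega
    obtain ⟨c', ⟨hc', hvc'⟩, hu⟩ := h.existsUnique _ hv
    refine ⟨(c \ c', c' \ c), ⟨mem_image_of_mem _ hc', (key c' hc').1 hvc'⟩, ?_⟩
    rintro b ⟨hb, hle⟩
    obtain ⟨c'', hc'', rfl⟩ := mem_image.1 hb
    rw [hu c'' ⟨hc'', (key c'' hc'').2 hle⟩]

variable {X Y : Finset α} {D : Finset (Finset α × Finset α)}

lemma IsLocalCode.swap (h : IsLocalCode X Y D) : IsLocalCode Y X (D.image Prod.swap) where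
  fst_subset := by
    intro b hb
    obtain ⟨b', hb', rfl⟩ := mem_image.1 hb
    exact h.snd_subset b' hb'
  snd_subset := by
    intro b hb
    obtain ⟨b', hb', rfl⟩ := mem_image.1 hb
    exact h.fst_subset b' hb'
  card_eq := by
    intro b hb
    obtain ⟨b', hb', rfl⟩ := mem_image.1 hb
    exact (h.card_eq b' hb').symm
  empty_mem := mem_image.2 ⟨_, h.empty_mem, rfl⟩
  existsUnique := by
    intro A B hA hB hAB
    obtain ⟨b, ⟨hb, hle⟩, hu⟩ := h.existsUnique B A hB hA hAB.symm
    have hcard := h.card_eq b hb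
    refine ⟨b.swap, ⟨mem_image_of_mem _ hb, ?_⟩, ?_⟩
    · simp only [Prod.fst_swap, Prod.snd_swap]
      omega
    · rintro b' ⟨hb', hle'⟩
      obtain ⟨b'', hb'', rfl⟩ := mem_image.1 hb'
      have hcard' := h.card_eq b'' hb''
      simp only [Prod.fst_swap, Prod.snd_swap] at hle'
      rw [hu b'' ⟨hb'', by omega⟩]

/-- The minimum distance of a perfect code is at least `3`. -/
lemma IsLocalCode.card_fst (h : IsLocalCode X Y D) {b : Finset α × Finset α} (hb : b ∈ D) :
    #b.1 = 0 ∨ 3 ≤ #b.1 := by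
  by_contra! hcon
  have hbc := h.card_eq b hb
  obtain ⟨x, hx⟩ := card_pos.1 (Nat.pos_of_ne_zero hcon.1)
  obtain ⟨y, hy⟩ := card_pos.1 (hbc ▸ Nat.pos_of_ne_zero hcon.1)
  -- the vertex `({x}, {y})` would be covered by both `b` and the base point
  obtain ⟨b', -, hu⟩ := h.existsUnique {x} {y} (singleton_subset_iff.2 (h.fst_subset b hb hx))
    (singleton_subset_iff.2 (h.snd_subset b hb hy)) rfl
  have h1 := hu b ⟨hb, by
    rw [singleton_inter_of_mem hx, singleton_inter_of_mem hy, card_singleton, card_singleton]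
    omega⟩
  have h2 := hu (∅, ∅) ⟨h.empty_mem, by simp⟩
  exact hcon.1 (by rw [h1, ← h2, card_empty])

lemma subset_of_card_le_card_inter {A A' : Finset α} (h : #A ≤ #(A ∩ A')) : A ⊆ A' :=
  inter_eq_left.1 (eq_of_subset_of_card_le inter_subset_left h)

/-- Each vertex at distance `2` from the base point is covered by a codeword at distance `3`. -/
lemma IsLocalCode.existsUnique_pair (h : IsLocalCode X Y D) {A B : Finset α} (hA : A ⊆ X)
    (hB : B ⊆ Y) (hA2 : #A = 2) (hB2 : #B = 2) :
    ∃! b, b ∈ layer D 3 ∧ A ⊆ b.1 ∧ B ⊆ b.2 := by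
  have key : ∀ b, b ∈ D ∧ #A + #b.1 ≤ #(A ∩ b.1) + #(B ∩ b.2) + 1 ↔
      b ∈ layer D 3 ∧ A ⊆ b.1 ∧ B ⊆ b.2 := by
    intro b
    rw [layer, mem_filter]
    constructor
    · rintro ⟨hb, hle⟩
      have h1 : #(A ∩ b.1) ≤ #A := card_le_card inter_subset_left
      have h2 : #(B ∩ b.2) ≤ #B := card_le_card inter_subset_left
      have h3 : #(A ∩ b.1) ≤ #b.1 := card_le_card inter_subset_right
      have h4 : #(B ∩ b.2) ≤ #b.2 := card_le_card inter_subset_right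
      have h5 := h.card_eq b hb
      have h6 := h.card_fst hb
      exact ⟨⟨hb, by omega⟩, subset_of_card_le_card_inter (by omega),
        subset_of_card_le_card_inter (by omega)⟩
    · rintro ⟨⟨hb, hb3⟩, hAb, hBb⟩
      refine ⟨hb, ?_⟩
      rw [inter_eq_left.2 hAb, inter_eq_left.2 hBb]
      omega
  obtain ⟨b, hb, hu⟩ := h.existsUnique A B hA hB (hA2.trans hB2.symm)
  exact ⟨b, (key b).1 hb, fun b' hb' => hu b' ((key b').2 hb')⟩

/-- Each vertex at distance `3` from the base point is covered by a codeword at distance `3`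
or `4`. -/
lemma IsLocalCode.existsUnique_triple (h : IsLocalCode X Y D) {A B : Finset α} (hA : A ⊆ X)
    (hB : B ⊆ Y) (hA3 : #A = 3) (hB3 : #B = 3) :
    ∃! b, b ∈ layer D 3 ∪ layer D 4 ∧ (#b.1 = 3 ∧ 5 ≤ #(A ∩ b.1) + #(B ∩ b.2) ∨
      #b.1 = 4 ∧ A ⊆ b.1 ∧ B ⊆ b.2) := by
  have key : ∀ b, b ∈ D ∧ #A + #b.1 ≤ #(A ∩ b.1) + #(B ∩ b.2) + 1 ↔
      b ∈ layer D 3 ∪ layer D 4 ∧ (#b.1 = 3 ∧ 5 ≤ #(A ∩ b.1) + #(B ∩ b.2) ∨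
        #b.1 = 4 ∧ A ⊆ b.1 ∧ B ⊆ b.2) := by
    intro b
    rw [mem_union, layer, layer, mem_filter, mem_filter]
    constructor
    · rintro ⟨hb, hle⟩
      have h1 : #(A ∩ b.1) ≤ #A := card_le_card inter_subset_left
      have h2 : #(B ∩ b.2) ≤ #B := card_le_card inter_subset_left
      have h3 : #(A ∩ b.1) ≤ #b.1 := card_le_card inter_subset_right
      have h4 : #(B ∩ b.2) ≤ #b.2 := card_le_card inter_subset_right
      have h5 := h.card_eq b hb
      have h6 := h.card_fst hb
      obtain h7 | h7 : #b.1 = 3 ∨ #b.1 = 4 := by omega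
      · exact ⟨Or.inl ⟨hb, h7⟩, Or.inl ⟨h7, by omega⟩⟩
      · exact ⟨Or.inr ⟨hb, h7⟩, Or.inr ⟨h7, subset_of_card_le_card_inter (by omega),
          subset_of_card_le_card_inter (by omega)⟩⟩
    · rintro ⟨hb, hb' | ⟨hb4, hAb, hBb⟩⟩
      · exact ⟨by tauto, by omega⟩
      · refine ⟨by tauto, ?_⟩
        rw [inter_eq_left.2 hAb, inter_eq_left.2 hBb]
        omega
  obtain ⟨b, hb, hu⟩ := h.existsUnique A B hA hB (hA3.trans hB3.symm)
  exact ⟨b, (key b).1 hb, fun b' hb' => hu b' ((key b').2 hb')⟩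

end Local

/-! ### Counting codewords at distance three -/

lemma mem_layer {α : Type*} {D : Finset (Finset α × Finset α)} {k : ℕ}
    {b : Finset α × Finset α} : b ∈ layer D k ↔ b ∈ D ∧ #b.1 = k :=
  mem_filter

lemma disjoint_layer {α : Type*} {D : Finset (Finset α × Finset α)} {k l : ℕ} (hkl : k ≠ l) :
    Disjoint (layer D k) (layer D l) :=
  disjoint_left.2 fun _ h h' => hkl ((mem_layer.1 h).2.symm.trans (mem_layer.1 h').2)

section Counting

variable {α : Type*} [DecidableEq α] {X Y : Finset α} {D : Finset (Finset α × Finset α)}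

lemma IsLocalCode.card_snd_of_mem_layer (h : IsLocalCode X Y D) {k : ℕ}
    {b : Finset α × Finset α} (hb : b ∈ layer D k) : #b.2 = k :=
  (h.card_eq b (mem_layer.1 hb).1).symm.trans (mem_layer.1 hb).2

/-- For a fixed pair `Q ⊆ Y` the triples `A` with `(A, B) ∈ D` and `Q ⊆ B` form a Steiner triple
system on `X`; here its blocks are counted. -/
lemma IsLocalCode.three_mul_card_layer_three (h : IsLocalCode X Y D) {Q : Finset α} (hQ : Q ⊆ Y)
    (hQ2 : #Q = 2) : 3 * #{b ∈ layer D 3 | Q ⊆ b.2} = (#X).choose 2 := by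
  rw [← card_powersetCard 2 X, card_eq_sum_card_of_existsUnique (powersetCard 2 X)
    {b ∈ layer D 3 | Q ⊆ b.2} (fun P b => P ⊆ b.1), sum_const_nat (m := 3), mul_comm]
  · intro b hb
    have hb' := mem_layer.1 (mem_filter.1 hb).1
    have : {P ∈ powersetCard 2 X | P ⊆ b.1} = powersetCard 2 b.1 := by
      ext P
      have := h.fst_subset b hb'.1
      simp only [mem_filter, mem_powersetCard]
      exact ⟨fun hP => ⟨hP.2, hP.1.2⟩, fun hP => ⟨⟨hP.1.trans this, hP.2⟩, hP.1⟩⟩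
    rw [this, card_powersetCard, hb'.2]
    rfl
  · intro P hP
    rw [mem_powersetCard] at hP
    obtain ⟨b, hb, hu⟩ := h.existsUnique_pair hP.1 hQ hP.2 hQ2
    exact ⟨b, ⟨mem_filter.2 ⟨hb.1, hb.2.2⟩, hb.2.1⟩, fun b' hb' =>
      hu b' ⟨(mem_filter.1 hb'.1).1, hb'.2, (mem_filter.1 hb'.1).2⟩⟩

/-- The number of blocks through a point in the Steiner triple system belonging to `Q`. -/
lemma IsLocalCode.two_mul_card_layer_three_mem (h : IsLocalCode X Y D) {Q : Finset α}
    (hQ : Q ⊆ Y) (hQ2 : #Q = 2) {u : α} (hu : u ∈ X) :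
    2 * #{b ∈ layer D 3 | u ∈ b.1 ∧ Q ⊆ b.2} = #X - 1 := by
  rw [← card_erase_of_mem hu, card_eq_sum_card_of_existsUnique (X.erase u)
    {b ∈ layer D 3 | u ∈ b.1 ∧ Q ⊆ b.2} (fun v b => v ∈ b.1), sum_const_nat (m := 2), mul_comm]
  · intro b hb
    rw [mem_filter] at hb
    have hb' := mem_layer.1 hb.1
    have : {v ∈ X.erase u | v ∈ b.1} = b.1.erase u := by
      ext v
      have : v ∈ b.1 → v ∈ X := fun hv => h.fst_subset b hb'.1 hv
      simp only [mem_filter, mem_erase]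
      tauto
    rw [this, card_erase_of_mem hb.2.1, hb'.2]
  · intro v hv
    rw [mem_erase] at hv
    obtain ⟨b, hb, hun⟩ := h.existsUnique_pair (A := {u, v})
      (insert_subset hu (singleton_subset_iff.2 hv.2)) hQ (card_pair hv.1.symm) hQ2
    simp only [insert_subset_iff, singleton_subset_iff] at hb hun
    exact ⟨b, ⟨mem_filter.2 ⟨hb.1, hb.2.1.1, hb.2.2⟩, hb.2.1.2⟩, fun b' hb' => by
      have := mem_filter.1 hb'.1
      exact hun b' ⟨this.1, ⟨this.2.1, hb'.2⟩, this.2.2⟩⟩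

lemma IsLocalCode.six_mul_card_layer_three_mem_snd (h : IsLocalCode X Y D) {x : α} (hx : x ∈ Y) :
    6 * #{b ∈ layer D 3 | x ∈ b.2} = (#Y - 1) * (#X).choose 2 := by
  have h1 := sum_card_bipartiteAbove_eq_sum_card_bipartiteBelow (s := Y.erase x)
    (t := {b ∈ layer D 3 | x ∈ b.2}) fun y b => y ∈ b.2
  simp only [bipartiteAbove, bipartiteBelow] at h1
  rw [sum_const_nat (m := 2) (s := {b ∈ layer D 3 | x ∈ b.2})] at h1
  · have h2 : ∀ y ∈ Y.erase x, 3 * #{b ∈ {b ∈ layer D 3 | x ∈ b.2} | y ∈ b.2} =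
        (#X).choose 2 := by
      intro y hy
      rw [mem_erase] at hy
      rw [← h.three_mul_card_layer_three (Q := {x, y})
        (insert_subset hx (singleton_subset_iff.2 hy.2)) (card_pair hy.1.symm), filter_filter]
      simp only [insert_subset_iff, singleton_subset_iff]
    have h3 := congrArg (3 * ·) h1
    simp only [mul_sum] at h3
    rw [sum_congr rfl h2, sum_const, smul_eq_mul, card_erase_of_mem hx] at h3
    omega
  · intro b hb
    rw [mem_filter] at hb
    have hb' := mem_layer.1 hb.1
    have : {y ∈ Y.erase x | y ∈ b.2} = b.2.erase x := by
      ext v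
      have : v ∈ b.2 → v ∈ Y := fun hv => h.snd_subset b hb'.1 hv
      simp only [mem_filter, mem_erase]
      tauto
    rw [this, card_erase_of_mem hb.2, h.card_snd_of_mem_layer hb.1]

/-! ### Counting codewords at distance four modulo eight -/

/-- The number of vertices `(A, Q ∪ {z})` covered by a codeword `(A₀, B₀)` at distance `3`: it is
`#Y - 2 + 3 * (#X - 3)`, `2` or `0` according as `#(Q ∩ B₀)` is `2`, `1` or `0`. The statement is
linear in `#(Q ∩ B₀)` and the indicator of `Q ⊆ B₀`, so that it can be summed over codewords. -/
lemma card_covered_of_card_eq_three {Q A₀ B₀ : Finset α} (hQ : Q ⊆ Y) (hQ2 : #Q = 2)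
    (hA₀ : A₀ ⊆ X) (hB₀ : B₀ ⊆ Y) (hA₀3 : #A₀ = 3) (hB₀3 : #B₀ = 3) :
    #{p ∈ powersetCard 3 X ×ˢ (Y \ Q) | 5 ≤ #(p.1 ∩ A₀) + #(insert p.2 Q ∩ B₀)} +
        (if Q ⊆ B₀ then 4 else 0) =
      (if Q ⊆ B₀ then #Y - 2 + 3 * (#X - 3) else 0) + 2 * #(Q ∩ B₀) := by
  have hle : ∀ A ∈ powersetCard 3 X, #(A ∩ A₀) ≤ 3 ∧ (#(A ∩ A₀) = 3 ↔ A = A₀) := by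
    intro A hA
    rw [mem_powersetCard] at hA
    refine ⟨hA₀3 ▸ card_le_card inter_subset_right, fun h => ?_, ?_⟩
    · exact eq_of_subset_of_card_le (subset_of_card_le_card_inter (by omega)) (by omega)
    · rintro rfl
      rw [inter_self, hA.2]
  have hins : ∀ z ∈ Y \ Q, #(insert z Q ∩ B₀) = #(Q ∩ B₀) + if z ∈ B₀ then 1 else 0 := by
    intro z hz
    split_ifs with hzB
    · rw [insert_inter_of_mem hzB, card_insert_of_notMem fun h =>
        (mem_sdiff.1 hz).2 (mem_inter.1 h).1]
    · rw [insert_inter_of_notMem hzB, add_zero]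
  have hA₀mem : A₀ ∈ powersetCard 3 X := mem_powersetCard.2 ⟨hA₀, hA₀3⟩
  have hsd := card_sdiff_add_card_inter B₀ Q
  rw [inter_comm] at hsd
  by_cases hQB : Q ⊆ B₀
  · have hQi : #(Q ∩ B₀) = 2 := by rw [inter_eq_left.2 hQB, hQ2]
    obtain ⟨z₀, hz₀⟩ := card_eq_one.1 (show #(B₀ \ Q) = 1 by omega)
    have hz₀' : ∀ z, z ∈ B₀ ∧ z ∉ Q ↔ z = z₀ := fun z => by
      rw [← mem_sdiff, hz₀, mem_singleton]
    have hz₀m := (hz₀' z₀).2 rfl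
    have hset : {p ∈ powersetCard 3 X ×ˢ (Y \ Q) | 5 ≤ #(p.1 ∩ A₀) + #(insert p.2 Q ∩ B₀)} =
        {A₀} ×ˢ (Y \ Q) ∪ {A ∈ powersetCard #A₀ X | #(A ∩ A₀) + 1 = #A₀} ×ˢ {z₀} := by
      ext ⟨A, z⟩
      simp only [mem_filter, mem_product, mem_union, mem_singleton, hA₀3]
      constructor
      · rintro ⟨⟨hA, hz⟩, h5⟩
        rw [hins z hz, hQi] at h5
        have h1 := hle A hA
        by_cases hAA : A = A₀
        · exact Or.inl ⟨hAA, hz⟩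
        · right
          have h2 : #(A ∩ A₀) ≠ 3 := fun h => hAA (h1.2.1 h)
          split_ifs at h5 with hzB
          · exact ⟨⟨hA, by omega⟩, (hz₀' z).1 ⟨hzB, (mem_sdiff.1 hz).2⟩⟩
          · omega
      · rintro (⟨rfl, hz⟩ | ⟨⟨hA, hA2⟩, rfl⟩)
        · refine ⟨⟨hA₀mem, hz⟩, ?_⟩
          rw [hins z hz, hQi, inter_self, hA₀3]
          omega
        · have hz : z ∈ Y \ Q := mem_sdiff.2 ⟨hB₀ hz₀m.1, hz₀m.2⟩
          refine ⟨⟨hA, hz⟩, ?_⟩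
          rw [hins z hz, hQi, if_pos hz₀m.1]
          omega
    have hdisj : Disjoint ({A₀} ×ˢ (Y \ Q))
        ({A ∈ powersetCard #A₀ X | #(A ∩ A₀) + 1 = #A₀} ×ˢ {z₀}) := by
      rw [disjoint_product]
      left
      rw [disjoint_singleton_left, mem_filter, inter_self]
      omega
    rw [hset, card_union_of_disjoint hdisj, card_product, card_product, card_singleton,
      card_singleton, card_filter_card_inter_add_one hA₀, card_sdiff_of_subset hQ, hQ2, hA₀3,
      if_pos hQB, if_pos hQB, hQi]
    ring
  · rw [if_neg hQB, if_neg hQB]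
    have hQi : #(Q ∩ B₀) < 2 := by
      by_contra! h2
      exact hQB (subset_of_card_le_card_inter (by omega))
    have hset : {p ∈ powersetCard 3 X ×ˢ (Y \ Q) | 5 ≤ #(p.1 ∩ A₀) + #(insert p.2 Q ∩ B₀)} =
        if #(Q ∩ B₀) = 1 then {A₀} ×ˢ (B₀ \ Q) else ∅ := by
      ext ⟨A, z⟩
      simp only [mem_filter, mem_product]
      constructor
      · rintro ⟨⟨hA, hz⟩, h5⟩
        rw [hins z hz] at h5
        have h1 := hle A hA
        split_ifs at h5 with hzB
        · rw [if_pos (by omega), mem_product, mem_singleton, mem_sdiff]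
          exact ⟨h1.2.1 (by omega), hzB, (mem_sdiff.1 hz).2⟩
        · omega
      · split_ifs with h1
        · rw [mem_product, mem_singleton, mem_sdiff]
          rintro ⟨hA, hzB, hzQ⟩
          obtain rfl : A = A₀ := hA
          have hz : z ∈ Y \ Q := mem_sdiff.2 ⟨hB₀ hzB, hzQ⟩
          refine ⟨⟨hA₀mem, hz⟩, ?_⟩
          rw [hins z hz, inter_self, hA₀3, if_pos hzB]
          omega
        · intro h
          exact absurd h (notMem_empty _)
    rw [hset]
    split_ifs with h1
    · rw [card_product, card_singleton]
      omega
    · rw [card_empty]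
      omega

lemma card_covered_of_card_eq_four {Q A₀ B₀ : Finset α} (hQ2 : #Q = 2)
    (hA₀ : A₀ ⊆ X) (hB₀ : B₀ ⊆ Y) (hA₀4 : #A₀ = 4) (hB₀4 : #B₀ = 4) :
    #{p ∈ powersetCard 3 X ×ˢ (Y \ Q) | p.1 ⊆ A₀ ∧ insert p.2 Q ⊆ B₀} =
      if Q ⊆ B₀ then 8 else 0 := by
  split_ifs with h
  · have : {p ∈ powersetCard 3 X ×ˢ (Y \ Q) | p.1 ⊆ A₀ ∧ insert p.2 Q ⊆ B₀} =
        powersetCard 3 A₀ ×ˢ (B₀ \ Q) := by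
      ext ⟨A, z⟩
      have := @hB₀ z
      have := fun h : A ⊆ A₀ => h.trans hA₀
      simp only [mem_filter, mem_product, mem_powersetCard, mem_sdiff, insert_subset_iff]
      tauto
    rw [this, card_product, card_powersetCard, card_sdiff_of_subset h, hA₀4, hB₀4, hQ2]
    rfl
  · rw [card_eq_zero, filter_eq_empty_iff]
    exact fun p _ hp => h ((subset_insert _ _).trans hp.2)

/-- The vertices `(A, B)` at distance `3` with `Q ⊆ B`, counted according to the codewords
covering them. -/
lemma IsLocalCode.choose_three_mul (h : IsLocalCode X Y D) {x y : α} (hx : x ∈ Y) (hy : y ∈ Y)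
    (hxy : x ≠ y) :
    (#X).choose 3 * (#Y - 2) + #{b ∈ layer D 3 | {x, y} ⊆ b.2} * 4 =
      #{b ∈ layer D 3 | {x, y} ⊆ b.2} * (#Y - 2 + 3 * (#X - 3)) +
        2 * (#{b ∈ layer D 3 | x ∈ b.2} + #{b ∈ layer D 3 | y ∈ b.2}) +
          #{b ∈ layer D 4 | {x, y} ⊆ b.2} * 8 := by
  set Q : Finset α := {x, y} with hQdef
  have hQ2 : #Q = 2 := card_pair hxy
  have hQ : Q ⊆ Y := insert_subset hx (singleton_subset_iff.2 hy)
  have hF : (#X).choose 3 * (#Y - 2) = #(powersetCard 3 X ×ˢ (Y \ Q)) := by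
    rw [card_product, card_powersetCard, card_sdiff_of_subset hQ, hQ2]
  have h3 : ∑ b ∈ layer D 3, #{p ∈ powersetCard 3 X ×ˢ (Y \ Q) |
        #b.1 = 3 ∧ 5 ≤ #(p.1 ∩ b.1) + #(insert p.2 Q ∩ b.2) ∨
          #b.1 = 4 ∧ p.1 ⊆ b.1 ∧ insert p.2 Q ⊆ b.2} + #{b ∈ layer D 3 | Q ⊆ b.2} * 4 =
      #{b ∈ layer D 3 | Q ⊆ b.2} * (#Y - 2 + 3 * (#X - 3)) +
        2 * (#{b ∈ layer D 3 | x ∈ b.2} + #{b ∈ layer D 3 | y ∈ b.2}) := by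
    have e1 : ∑ b ∈ layer D 3, #(Q ∩ b.2) =
        #{b ∈ layer D 3 | x ∈ b.2} + #{b ∈ layer D 3 | y ∈ b.2} := by
      rw [card_filter, card_filter, ← sum_add_distrib]
      refine sum_congr rfl fun b _ => ?_
      rw [← filter_mem_eq_inter, card_filter, hQdef, sum_pair hxy]
    rw [← e1, card_filter, sum_mul, sum_mul, mul_sum, ← sum_add_distrib, ← sum_add_distrib]
    refine sum_congr rfl fun b hb => ?_
    have hb' := mem_layer.1 hb
    have := card_covered_of_card_eq_three (X := X) hQ hQ2 (h.fst_subset b hb'.1)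
      (h.snd_subset b hb'.1) hb'.2 (h.card_snd_of_mem_layer hb)
    simp only [ite_mul, one_mul, zero_mul, ← this]
    simp [hb'.2]
  have h4 : ∑ b ∈ layer D 4, #{p ∈ powersetCard 3 X ×ˢ (Y \ Q) |
        #b.1 = 3 ∧ 5 ≤ #(p.1 ∩ b.1) + #(insert p.2 Q ∩ b.2) ∨
          #b.1 = 4 ∧ p.1 ⊆ b.1 ∧ insert p.2 Q ⊆ b.2} = #{b ∈ layer D 4 | Q ⊆ b.2} * 8 := by
    rw [card_filter, sum_mul]
    refine sum_congr rfl fun b hb => ?_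
    have hb' := mem_layer.1 hb
    have := card_covered_of_card_eq_four hQ2 (h.fst_subset b hb'.1)
      (h.snd_subset b hb'.1) hb'.2 (h.card_snd_of_mem_layer hb)
    simp only [ite_mul, one_mul, zero_mul, ← this]
    simp [hb'.2]
  rw [hF, card_eq_sum_card_of_existsUnique _ (layer D 3 ∪ layer D 4)
    (fun p b => #b.1 = 3 ∧ 5 ≤ #(p.1 ∩ b.1) + #(insert p.2 Q ∩ b.2) ∨
      #b.1 = 4 ∧ p.1 ⊆ b.1 ∧ insert p.2 Q ⊆ b.2), sum_union (disjoint_layer (by norm_num)), h4,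
    ← h3]
  · ring
  · rintro ⟨A, z⟩ hp
    rw [mem_product, mem_powersetCard, mem_sdiff] at hp
    exact h.existsUnique_triple hp.1.1 (insert_subset hp.2.1 hQ) hp.1.2
      (by rw [card_insert_of_notMem hp.2.2, hQ2])

end Counting

/-! ### Counting codewords at distance four modulo three -/

section ModThree

variable {α : Type*} [DecidableEq α] {X Y : Finset α} {D : Finset (Finset α × Finset α)}

/-- There are `(#X - 1).choose 2` vertices `(A, B)` with `u ∈ A` and the given `B`. If none of
them is covered by a codeword `(A', B)` with `u ∈ A'`, then they are covered either three at a
time, or by codewords `(A, B')` with `#(B ∩ B') = 2`, of which there are equally many for each of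
the three pairs in `B`. -/
lemma IsLocalCode.three_dvd_choose (h : IsLocalCode X Y D) {u : α} (hu : u ∈ X) {B : Finset α}
    (hB : B ⊆ Y) (hB3 : #B = 3) (hno : ∀ b ∈ layer D 3, b.2 = B → u ∉ b.1) :
    3 ∣ (#X - 1).choose 2 := by
  rw [← card_erase_of_mem hu, ← card_powersetCard,
    card_eq_sum_card_of_existsUnique _ (layer D 3 ∪ layer D 4)
    (fun R b => #b.1 = 3 ∧ 5 ≤ #(insert u R ∩ b.1) + #(B ∩ b.2) ∨
      #b.1 = 4 ∧ insert u R ⊆ b.1 ∧ B ⊆ b.2), sum_union (disjoint_layer (by norm_num))]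
  · refine dvd_add ?_ (dvd_sum fun b hb => ?_)
    · have h1 : ∀ b ∈ layer D 3, #{R ∈ powersetCard 2 (X.erase u) |
          #b.1 = 3 ∧ 5 ≤ #(insert u R ∩ b.1) + #(B ∩ b.2) ∨
            #b.1 = 4 ∧ insert u R ⊆ b.1 ∧ B ⊆ b.2} =
          (if b.2 = B then 3 else 0) + #{Q ∈ powersetCard 2 B | u ∈ b.1 ∧ Q ⊆ b.2} := by
        intro b hb
        have hb' := mem_layer.1 hb
        have hbX := h.fst_subset b hb'.1
        have hb2 := h.card_snd_of_mem_layer hb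
        have hcR : ∀ R ∈ powersetCard 2 (X.erase u), #(insert u R) = 3 := by
          intro R hR
          rw [mem_powersetCard] at hR
          rw [card_insert_of_notMem fun hm => (mem_erase.1 (hR.1 hm)).1 rfl, hR.2]
        by_cases hbB : b.2 = B
        -- `(A', B)` with `u ∉ A'` covers the `A` consisting of `u` and a pair in `A'`
        · have hub := hno b hb hbB
          have e1 : {R ∈ powersetCard 2 (X.erase u) |
              #b.1 = 3 ∧ 5 ≤ #(insert u R ∩ b.1) + #(B ∩ b.2) ∨
                #b.1 = 4 ∧ insert u R ⊆ b.1 ∧ B ⊆ b.2} = powersetCard 2 b.1 := by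
            ext R
            simp only [mem_filter, mem_powersetCard, hb'.2, hbB, inter_self, hB3,
              insert_inter_of_notMem hub]
            constructor
            · rintro ⟨⟨_, hR2⟩, h5⟩
              exact ⟨subset_of_card_le_card_inter (by omega), hR2⟩
            · rintro ⟨hR, hR2⟩
              refine ⟨⟨fun z hz => mem_erase.2 ⟨fun e => hub (e ▸ hR hz), hbX (hR hz)⟩, hR2⟩,
                Or.inl ⟨trivial, ?_⟩⟩
              rw [inter_eq_left.2 hR]
              omega
          have e2 : {Q ∈ powersetCard 2 B | u ∈ b.1 ∧ Q ⊆ b.2} = ∅ := by simp [hub]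
          rw [e1, e2, card_powersetCard, hb'.2, if_pos hbB, card_empty]
          rfl
        · have hBb : #(B ∩ b.2) ≤ 2 := by
            by_contra! h3
            exact hbB (eq_of_subset_of_card_le
              (subset_of_card_le_card_inter (by omega)) (by omega)).symm
          rw [if_neg hbB, zero_add]
          by_cases hub : u ∈ b.1 ∧ #(B ∩ b.2) = 2
          -- only `A = A'` is covered, and `B ∩ B'` is the only pair counted on the right
          · have e1 : {R ∈ powersetCard 2 (X.erase u) |
                #b.1 = 3 ∧ 5 ≤ #(insert u R ∩ b.1) + #(B ∩ b.2) ∨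
                  #b.1 = 4 ∧ insert u R ⊆ b.1 ∧ B ⊆ b.2} = {b.1.erase u} := by
              ext R
              rw [mem_filter, mem_singleton, hb'.2, hub.2]
              constructor
              · rintro ⟨hR, h5⟩
                have hR3 := hcR R hR
                rw [mem_powersetCard] at hR
                have : insert u R = b.1 := eq_of_subset_of_card_le
                  (subset_of_card_le_card_inter (by omega)) (by omega)
                rw [← this, erase_insert fun hm => (mem_erase.1 (hR.1 hm)).1 rfl]
              · rintro rfl
                refine ⟨mem_powersetCard.2 ⟨erase_subset_erase _ hbX, ?_⟩, ?_⟩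
                · rw [card_erase_of_mem hub.1, hb'.2]
                · rw [insert_erase hub.1, inter_self]
                  omega
            have e2 : {Q ∈ powersetCard 2 B | u ∈ b.1 ∧ Q ⊆ b.2} =
                powersetCard 2 (B ∩ b.2) := by
              ext Q
              simp only [mem_filter, mem_powersetCard, subset_inter_iff, hub.1, true_and]
              tauto
            rw [e1, e2, card_singleton, card_powersetCard, hub.2]
            rfl
          · have e1 : {R ∈ powersetCard 2 (X.erase u) |
                #b.1 = 3 ∧ 5 ≤ #(insert u R ∩ b.1) + #(B ∩ b.2) ∨
                  #b.1 = 4 ∧ insert u R ⊆ b.1 ∧ B ⊆ b.2} = ∅ := by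
              rw [filter_eq_empty_iff]
              intro R hR h5
              have hR3 := hcR R hR
              have hle : #(insert u R ∩ b.1) ≤ #(insert u R) := card_le_card inter_subset_left
              have hs : insert u R ⊆ b.1 := subset_of_card_le_card_inter (by omega)
              exact hub ⟨hs (mem_insert_self _ _), by omega⟩
            have e2 : {Q ∈ powersetCard 2 B | u ∈ b.1 ∧ Q ⊆ b.2} = ∅ := by
              rw [filter_eq_empty_iff]
              rintro Q hQ ⟨hub', hQb⟩
              rw [mem_powersetCard] at hQ
              have := card_le_card (subset_inter hQ.1 hQb)
              exact hub ⟨hub', by omega⟩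
            rw [e1, e2]
      rw [sum_congr rfl h1, sum_add_distrib]
      refine dvd_add (dvd_sum fun b _ => by split_ifs <;> simp) ?_
      have h2 := sum_card_bipartiteAbove_eq_sum_card_bipartiteBelow (s := layer D 3)
        (t := powersetCard 2 B) fun b Q => u ∈ b.1 ∧ Q ⊆ b.2
      simp only [bipartiteAbove, bipartiteBelow] at h2
      rw [h2, sum_const_nat (m := (#X - 1) / 2), card_powersetCard, hB3]
      · exact Dvd.intro _ rfl
      · intro Q hQ
        rw [mem_powersetCard] at hQ
        have := h.two_mul_card_layer_three_mem (hQ.1.trans hB) hQ.2 hu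
        omega
    · have hb' := mem_layer.1 hb
      by_cases hub : u ∈ b.1 ∧ B ⊆ b.2
      · have e1 : {R ∈ powersetCard 2 (X.erase u) |
            #b.1 = 3 ∧ 5 ≤ #(insert u R ∩ b.1) + #(B ∩ b.2) ∨
              #b.1 = 4 ∧ insert u R ⊆ b.1 ∧ B ⊆ b.2} = powersetCard 2 (b.1.erase u) := by
          ext R
          simp only [mem_filter, mem_powersetCard, hb'.2, hub, insert_subset_iff, subset_erase]
          have : R ⊆ b.1 → R ⊆ X := fun hR => hR.trans (h.fst_subset b hb'.1)
          norm_num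
          tauto
        rw [e1, card_powersetCard, card_erase_of_mem hub.1, hb'.2]
        exact dvd_rfl
      · rw [filter_false_of_mem, card_empty]
        · exact dvd_zero 3
        · rintro R - (⟨h3, -⟩ | ⟨-, hR, hBb⟩)
          · omega
          · exact hub ⟨hR (mem_insert_self _ _), hBb⟩
  · intro R hR
    rw [mem_powersetCard, subset_erase] at hR
    exact h.existsUnique_triple (insert_subset hu hR.1.1) hB
      (by rw [card_insert_of_notMem hR.1.2, hR.2]) hB3

/-- If `3 ∣ #X`, then for each `u ∈ X` and each pair `Q ⊆ Y` all triples containing `Q` occur as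
`B` in a codeword `(A, B)` with `u ∈ A`, so there are at most as many of them as such
codewords. -/
lemma IsLocalCode.two_mul_card_le_of_three_dvd (h : IsLocalCode X Y D) (hX : X.Nonempty)
    (hX3 : 3 ∣ #X) (hY : 2 ≤ #Y) : 2 * (#Y - 2) ≤ #X - 1 := by
  obtain ⟨u, hu⟩ := hX
  obtain ⟨Q, hQ, hQ2⟩ := exists_subset_card_eq hY
  have hpos : 0 < #X := card_pos.2 ⟨u, hu⟩
  have hnd : ¬ 3 ∣ (#X - 1).choose 2 := by
    intro h3
    have h4 : 3 ∣ (#X - 1) * (#X - 1 - 1) := by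
      rw [← Nat.div_two_mul_two_of_even (Nat.even_mul_pred_self (#X - 1)),
        ← Nat.choose_two_right]
      exact h3.mul_right 2
    rcases (Nat.prime_three.dvd_mul).1 h4 with h5 | h5 <;> omega
  have hex : ∀ z ∈ Y \ Q, ∃ b ∈ layer D 3, b.2 = insert z Q ∧ u ∈ b.1 := by
    intro z hz
    rw [mem_sdiff] at hz
    by_contra! hno
    exact hnd (h.three_dvd_choose hu (insert_subset hz.1 hQ)
      (by rw [card_insert_of_notMem hz.2, hQ2]) hno)
  choose! f hf hf2 hfu using hex
  rw [← h.two_mul_card_layer_three_mem hQ hQ2 hu, ← hQ2, ← card_sdiff_of_subset hQ, hQ2]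
  refine Nat.mul_le_mul_left 2 (card_le_card_of_injOn f ?_ ?_)
  · intro z hz
    rw [mem_coe] at hz
    exact mem_filter.2 ⟨hf z hz, hfu z hz, (hf2 z hz).symm ▸ subset_insert _ _⟩
  · intro z hz z' hz' he
    rw [mem_coe] at hz hz'
    have h1 : insert z Q = insert z' Q := by rw [← hf2 z hz, ← hf2 z' hz', he]
    have h2 : z ∈ insert z' Q := h1 ▸ mem_insert_self z Q
    exact (mem_insert.1 h2).resolve_right (mem_sdiff.1 hz).2

/-! ### Congruences for the sizes of a codeword and its complement -/

lemma IsLocalCode.steiner_conditions (h : IsLocalCode X Y D) (hX : X.Nonempty) (hY : 2 ≤ #Y) :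
    #X % 2 = 1 ∧ #X % 3 ≠ 2 := by
  obtain ⟨u, hu⟩ := hX
  obtain ⟨Q, hQ, hQ2⟩ := exists_subset_card_eq hY
  have hpos : 0 < #X := card_pos.2 ⟨u, hu⟩
  have h1 := h.two_mul_card_layer_three_mem hQ hQ2 hu
  have h2 := h.three_mul_card_layer_three hQ hQ2
  refine ⟨by omega, fun h3 => ?_⟩
  have h4 : 3 ∣ #X * (#X - 1) := by
    rw [← Nat.div_two_mul_two_of_even (Nat.even_mul_pred_self #X), ← Nat.choose_two_right, ← h2]
    exact (Dvd.intro _ rfl).mul_right 2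
  rcases (Nat.prime_three.dvd_mul).1 h4 with h5 | h5 <;> omega

lemma IsLocalCode.mod_four (h : IsLocalCode X Y D) (hY : 2 ≤ #Y) :
    ¬ (#X % 4 = 3 ∧ #Y % 4 = 1) := by
  rintro ⟨hX4, hY4⟩
  obtain ⟨x, hx, y, hy, hxy⟩ := one_lt_card.1 (show 1 < #Y by omega)
  have h1 := h.choose_three_mul hx hy hxy
  have h2 := h.three_mul_card_layer_three (insert_subset hx (singleton_subset_iff.2 hy))
    (card_pair hxy)
  have hRx := h.six_mul_card_layer_three_mem_snd hx
  have hRy := h.six_mul_card_layer_three_mem_snd hy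
  set M := #{b ∈ layer D 3 | {x, y} ⊆ b.2}
  set Rx := #{b ∈ layer D 3 | x ∈ b.2}
  set Ry := #{b ∈ layer D 3 | y ∈ b.2}
  set K := #{b ∈ layer D 4 | {x, y} ⊆ b.2}
  obtain ⟨s, hs⟩ : ∃ s, #X = 4 * s + 3 := ⟨#X / 4, by omega⟩
  obtain ⟨r, hr⟩ : ∃ r, #Y = 4 * r + 5 := ⟨(#Y - 5) / 4, by omega⟩
  rw [hs] at h1 h2 hRx hRy
  rw [hr] at h1 hRx hRy
  have hc3 : (4 * s + 3).choose 3 = M * (4 * s + 1) := by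
    have := Nat.choose_succ_right_eq (4 * s + 3) 2
    have e : 4 * s + 3 - 2 = 4 * s + 1 := by omega
    rw [← h2, e] at this
    linarith
  have hM : 3 * M = (4 * s + 3) * (2 * s + 1) := by
    have := Nat.choose_two_right (4 * s + 3)
    rw [h2, this, show 4 * s + 3 - 1 = (2 * s + 1) * 2 by omega, ← mul_assoc,
      Nat.mul_div_cancel _ two_pos]
  have hMo : Odd M := by
    have : Odd (3 * M) := hM ▸ Odd.mul ⟨2 * s + 1, by ring⟩ ⟨s, by ring⟩
    exact (Nat.odd_mul.1 this).2
  obtain ⟨μ, hμ⟩ := hMo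
  rw [← h2, show 4 * r + 5 - 1 = 4 * r + 4 by omega] at hRx hRy
  rw [hc3, show 4 * r + 5 - 2 = 4 * r + 3 by omega, show 4 * s + 3 - 3 = 4 * s by omega] at h1
  have hR : Rx + Ry = M * (4 * r + 4) := by linarith
  rw [hR] at h1
  -- the coefficient of `M` is `4` modulo `8`
  have h8 : 4 * (M : ℤ) = 8 * (K + M * (r + 1 - 2 * s * r)) := by
    have h1' : ((M * (4 * s + 1) * (4 * r + 3) + M * 4 : ℕ) : ℤ) =
      (M * (4 * r + 3 + 3 * (4 * s)) + 2 * (M * (4 * r + 4)) + K * 8 : ℕ) := by rw [h1]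
    push_cast at h1'
    linarith
  omega

end ModThree

section Trivial

variable {α : Type*} [DecidableEq α] [Fintype α]

/-- The only perfect codes in `J(6, 3)` are the pairs of complementary sets. -/
lemma IsPerfectFamily.eq_pair_compl {𝒞 : Finset (Finset α)} (h : IsPerfectFamily 3 𝒞)
    (hα : Fintype.card α = 6) {c : Finset α} (hc : c ∈ 𝒞) : 𝒞 = {c, cᶜ} := by
  have hc3 := h.card_eq c hc
  have hcc3 : #cᶜ = 3 := by rw [card_compl, hα, hc3]
  have hL := h.isLocalCode hc
  have hcc : cᶜ ∈ 𝒞 := by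
    obtain ⟨A, hA, hA2⟩ := exists_subset_card_eq (show 2 ≤ #c by omega)
    obtain ⟨B, hB, hB2⟩ := exists_subset_card_eq (show 2 ≤ #cᶜ by omega)
    obtain ⟨b, ⟨hb, -, -⟩, -⟩ := hL.existsUnique_pair hA hB hA2 hB2
    rw [mem_layer] at hb
    obtain ⟨c', hc', rfl⟩ := mem_image.1 hb.1
    have h1 : c \ c' = c := eq_of_subset_of_card_le sdiff_subset (by rw [hb.2, hc3])
    have h2 : c' ⊆ cᶜ := subset_compl_iff_disjoint_right.2 (sdiff_eq_left.1 h1).symm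
    have h3 : c' = cᶜ := eq_of_subset_of_card_le h2 (by rw [h.card_eq c' hc', hcc3])
    exact h3 ▸ hc'
  ext v
  rw [mem_insert, mem_singleton]
  constructor
  · intro hv
    have hv3 := h.card_eq v hv
    obtain ⟨c', -, hu⟩ := h.existsUnique v hv3
    have h1 := hu v ⟨hv, by rw [inter_self, hv3]; omega⟩
    have h2 := card_sdiff_add_card_inter v c
    rw [sdiff_eq_inter_compl] at h2
    by_cases h4 : 3 ≤ #(v ∩ c) + 1
    · exact Or.inl (h1.trans (hu c ⟨hc, h4⟩).symm)
    · exact Or.inr (h1.trans (hu cᶜ ⟨hcc, by omega⟩).symm)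
  · rintro (rfl | rfl)
    · exact hc
    · exact hcc

end Trivial

/-! ### The parameters of a nontrivial perfect code -/

/-- The integer of the divisibility condition is the number of blocks through a `t`-set of the
design, where `t = k * m`. -/
lemma prod_div_eq_of_degree {k m l : ℕ} (hk : 0 < k)
    (hl : l * (1 + (k * (m + 1) + 1) * ((k + 1) * m + 1)) =
      ((k + 1) * (m + 1) + 1).choose (k + 1)) :
    (∏ i ∈ range k, (((k * (m + 1) + 1 : ℕ) : ℚ) * ((k + 1 : ℕ) : ℚ) -
        (((k + 1 : ℕ) : ℚ) + (i : ℚ) * (((k + 1 : ℕ) : ℚ) - 1)))) /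
      ((k.factorial : ℚ) * (((k + 1 : ℕ) : ℚ) - 1) ^ k * ((k + 1 : ℕ) : ℚ) *
        (((k * (m + 1) + 1 : ℕ) : ℚ) - ((k + 1 : ℕ) : ℚ) + 1)) = l := by
  have h1 := Nat.add_one_mul_choose_eq ((k + 1) * (m + 1)) k
  -- the ball has `(k * m + 1) * ((k + 1) * (m + 1) + 1)` elements
  have h2 : ((k + 1) * (m + 1)).choose k = l * (k * m + 1) * (k + 1) := by
    have hpos : 0 < (k + 1) * (m + 1) + 1 := by positivity
    refine Nat.eq_of_mul_eq_mul_left hpos ?_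
    rw [h1, ← hl]
    ring
  have h3 := Nat.descFactorial_eq_factorial_mul_choose ((k + 1) * (m + 1)) k
  rw [Nat.descFactorial_eq_prod_range, h2] at h3
  have h4 : ∏ i ∈ range k, (((k * (m + 1) + 1 : ℕ) : ℚ) * ((k + 1 : ℕ) : ℚ) -
        (((k + 1 : ℕ) : ℚ) + (i : ℚ) * (((k + 1 : ℕ) : ℚ) - 1))) =
      (k : ℚ) ^ k * ((∏ i ∈ range k, ((k + 1) * (m + 1) - i) : ℕ) : ℚ) := by
    rw [Nat.cast_prod]
    conv_rhs => rw [← card_range k, ← prod_const, card_range, ← prod_mul_distrib]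
    refine prod_congr rfl fun i hi => ?_
    rw [mem_range] at hi
    rw [Nat.cast_sub (by nlinarith)]
    push_cast
    ring
  rw [h4, h3]
  have hk' : (k : ℚ) ≠ 0 := by exact_mod_cast hk.ne'
  have hf : (k.factorial : ℚ) ≠ 0 := by exact_mod_cast k.factorial_ne_zero
  have hkm : (k : ℚ) * m + 1 ≠ 0 := by positivity
  have hk1 : (k : ℚ) + 1 ≠ 0 := by positivity
  have e1 : ((k * (m + 1) + 1 : ℕ) : ℚ) - ((k + 1 : ℕ) : ℚ) + 1 = k * m + 1 := by
    push_cast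
    ring
  rw [e1]
  push_cast
  rw [add_sub_cancel_right]
  field_simp

/-- Here `k * (m + 1) + 1` and `(k + 1) * m + 1` are the sizes of a codeword and of its
complement, and `k * m` is the strength. -/
lemma mod_three_of_sizes {k m : ℕ} (hX : (k * (m + 1) + 1) % 3 = 1)
    (hY : ((k + 1) * m + 1) % 3 ≠ 2) :
    (k % 3 = 2 ∨ k % 3 = 0) ∧ (k * m % 3 = 0 ∨ k * m % 3 = 1) := by
  have key : ∀ r s : Fin 3, (r.1 * (s.1 + 1) + 1) % 3 = 1 →
      ((r.1 + 1) * s.1 + 1) % 3 ≠ 2 →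
      (r.1 = 2 ∨ r.1 = 0) ∧ (r.1 * s.1 % 3 = 0 ∨ r.1 * s.1 % 3 = 1) := by decide
  have h := key ⟨k % 3, Nat.mod_lt _ (by norm_num)⟩ ⟨m % 3, Nat.mod_lt _ (by norm_num)⟩
  have e1 : (k % 3 * (m % 3 + 1) + 1) % 3 = (k * (m + 1) + 1) % 3 := by
    simp [Nat.add_mod, Nat.mul_mod]
  have e2 : ((k % 3 + 1) * (m % 3) + 1) % 3 = ((k + 1) * m + 1) % 3 := by
    simp [Nat.add_mod, Nat.mul_mod]
  simp only [e1, e2, ← Nat.mul_mod] at h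
  exact h hX hY

lemma mod_four_of_sizes {k m : ℕ} (hX : (k * (m + 1) + 1) % 2 = 1)
    (hY : ((k + 1) * m + 1) % 2 = 1)
    (hXY : ¬ ((k * (m + 1) + 1) % 4 = 3 ∧ ((k + 1) * m + 1) % 4 = 1))
    (hYX : ¬ (((k + 1) * m + 1) % 4 = 3 ∧ (k * (m + 1) + 1) % 4 = 1)) :
    k * m % 4 = 0 ∨ k * m % 4 = 1 := by
  have key : ∀ r s : Fin 4, (r.1 * (s.1 + 1) + 1) % 4 % 2 = 1 →
      ((r.1 + 1) * s.1 + 1) % 4 % 2 = 1 →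
      ¬ ((r.1 * (s.1 + 1) + 1) % 4 = 3 ∧ ((r.1 + 1) * s.1 + 1) % 4 = 1) →
      ¬ (((r.1 + 1) * s.1 + 1) % 4 = 3 ∧ (r.1 * (s.1 + 1) + 1) % 4 = 1) →
      (r.1 * s.1 % 4 = 0 ∨ r.1 * s.1 % 4 = 1) := by decide
  have h := key ⟨k % 4, Nat.mod_lt _ (by norm_num)⟩ ⟨m % 4, Nat.mod_lt _ (by norm_num)⟩
  have e1 : (k % 4 * (m % 4 + 1) + 1) % 4 = (k * (m + 1) + 1) % 4 := by
    simp [Nat.add_mod, Nat.mul_mod]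
  have e2 : ((k % 4 + 1) * (m % 4) + 1) % 4 = ((k + 1) * m + 1) % 4 := by
    simp [Nat.add_mod, Nat.mul_mod]
  simp only [e1, e2, ← Nat.mul_mod] at h
  exact h (by omega) (by omega) hXY hYX

/-- Every perfect code in the complete graph `J(n, 1)` is a singleton. -/
lemma IsPerfectCode.eq_singleton {n : ℕ} {C : Set (JohnsonSpace n 1)} (hC : IsPerfectCode 1 C)
    (hn : 0 < n) : ∃ v, C = {v} := by
  obtain ⟨c, ⟨hcC, -⟩, hu⟩ := hC ⟨{⟨0, hn⟩}, card_singleton _⟩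
  refine ⟨c, Set.eq_singleton_iff_unique_mem.2 ⟨hcC, fun v hv => hu v ⟨hv, ?_⟩⟩⟩
  rw [johnsonGraph_edist_le_one]
  omega

/-- A perfect code in `J(6, 3)` is trivial. -/
lemma IsPerfectCode.isTrivialCode_of_three {n w : ℕ} {C : Set (JohnsonSpace n w)}
    (hC : IsPerfectCode 1 C) (hw : w = 3) (hn : n = 6) : IsTrivialCode C := by
  subst hw hn
  have hP := hC.isPerfectFamily
  obtain ⟨c, hc⟩ := hP.nonempty (by simp)
  have hpair := hP.eq_pair_compl (by simp) hc
  have hcc : cᶜ ∈ codeFamily C := by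
    rw [hpair]
    simp
  refine Or.inr (Or.inr ⟨rfl, by decide, ⟨c, hP.card_eq c hc⟩, ⟨cᶜ, hP.card_eq _ hcc⟩,
    disjoint_compl_right, ?_⟩)
  ext v
  have h1 : v ∈ C ↔ v.1 = c ∨ v.1 = cᶜ := by
    rw [show v.1 = c ∨ v.1 = cᶜ ↔ v.1 ∈ codeFamily C by rw [hpair, mem_insert, mem_singleton],
      mem_codeFamily]
    exact ⟨fun h => ⟨v.2, h⟩, fun ⟨_, h⟩ => h⟩
  rw [Set.mem_insert_iff, Set.mem_singleton_iff, Subtype.ext_iff, Subtype.ext_iff, h1]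

theorem mainTheorem1 (w a d : ℕ) (C : Set (JohnsonSpace (2 * w + a) w))
    (hC : IsPerfectCode 1 C) (hnt : ¬ IsTrivialCode C)
    (hdw : d ≤ w) (hstr : HasStrength C (w - d)) :
    1 < d ∧
    (d ≡ 0 [MOD 3] ∨ d ≡ 1 [MOD 3]) ∧
    (w - d ≡ 0 [MOD 12] ∨ w - d ≡ 1 [MOD 12] ∨ w - d ≡ 4 [MOD 12] ∨ w - d ≡ 9 [MOD 12]) ∧
    (a : ℚ) = ((w : ℚ) - (d : ℚ) ^ 2 + (d : ℚ) - 1) / ((d : ℚ) - 1) ∧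
    ∃ z : ℤ,
      (∏ i ∈ Finset.range (d - 1),
          ((w : ℚ) * (d : ℚ) - ((d : ℚ) + (i : ℚ) * ((d : ℚ) - 1)))) /
        (((d - 1).factorial : ℚ) * ((d : ℚ) - 1) ^ (d - 1) * (d : ℚ) *
          ((w : ℚ) - (d : ℚ) + 1)) = (z : ℚ) := by
  obtain ⟨l, hl⟩ := hstr.1
  rcases Nat.eq_zero_or_pos d with rfl | hd0
  · exact absurd (Or.inl hl.eq_univ) hnt
  have hE := hstr.eigenvalue_eq_zero hC (by omega)
  obtain ⟨k, rfl⟩ : ∃ k, d = k + 1 := ⟨d - 1, by omega⟩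
  obtain ⟨t, rfl⟩ : ∃ t, w = t + k + 1 := ⟨w - (k + 1), by omega⟩
  have ht : t + k + 1 - (k + 1) = t := by omega
  rw [ht] at hE hl hstr ⊢
  have hkm : t = k * (a + k) := by
    push_cast at hE
    zify
    linarith
  have hk : 0 < k := by
    rcases Nat.eq_zero_or_pos k with rfl | hk
    · -- the equation gives `w = 1`
      obtain rfl : t = 0 := by simpa using hkm
      exact absurd (Or.inr (Or.inl ⟨by omega, hC.eq_singleton (by omega)⟩)) hnt
    · exact hk
  obtain ⟨m, hm⟩ : ∃ m, m = a + k := ⟨_, rfl⟩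
  rw [← hm] at hkm
  have hX : t + k + 1 = k * (m + 1) + 1 := by rw [hkm]; ring
  have hN : t + k + 1 + a = (k + 1) * m + 1 := by rw [hkm, hm]; ring
  have hP := hC.isPerfectFamily
  obtain ⟨c, hc⟩ := hP.nonempty (by simp; omega)
  have hL := hP.isLocalCode hc
  have hcX := hP.card_eq c hc
  have hcY : #cᶜ = t + k + 1 + a := by rw [card_compl, hcX, Fintype.card_fin]; omega
  have hcne : c.Nonempty := card_pos.1 (by omega)
  have hcne' : cᶜ.Nonempty := card_pos.1 (by omega)
  have hS := hL.steiner_conditions hcne (by omega)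
  have hS' := hL.swap.steiner_conditions hcne' (by omega)
  have h4 := hL.mod_four (by omega)
  have h4' := hL.swap.mod_four (by omega)
  -- if `3 ∣ w`, then `2 * (w + a - 2) ≤ w - 1`, which leaves only `J(6, 3)`
  have h3 : #c % 3 ≠ 0 := by
    intro h0
    have h5 := hL.two_mul_card_le_of_three_dvd hcne (Nat.dvd_of_mod_eq_zero h0) (by omega)
    exact hnt (hC.isTrivialCode_of_three (by omega) (by omega))
  rw [hcX] at hS h3 h4 h4'
  rw [hcY] at hS' h4 h4'
  rw [hN] at hS' h4 h4'
  rw [hX] at hS h3 h4 h4'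
  have h6 := mod_three_of_sizes (k := k) (m := m) (by omega) hS'.2
  have h7 := mod_four_of_sizes hS.1 hS'.1 h4 h4'
  rw [← hkm] at h6 h7
  refine ⟨by omega, ?_, ?_, ?_, l, ?_⟩
  · clear * - h6
    simp only [Nat.ModEq]
    omega
  · clear * - h6 h7
    simp only [Nat.ModEq]
    omega
  · have hk' : (k : ℚ) ≠ 0 := by exact_mod_cast hk.ne'
    rw [hkm, hm]
    push_cast
    rw [add_sub_cancel_right]
    field_simp
    ring
  · have h8 := hl.degree_mul_ball hC
    have h9 := prod_div_eq_of_degree (k := k) (m := m) (l := l) hk (by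
      rw [← hX, ← hN]
      have e1 : 2 * (t + k + 1) + a - (t + k + 1) = t + k + 1 + a := by omega
      have e2 : 2 * (t + k + 1) + a - t = (k + 1) * (m + 1) + 1 := by
        have : (k + 1) * (m + 1) = (k + 1) * m + 1 + k := by ring
        omega
      have e3 : t + k + 1 - t = k + 1 := by omega
      rwa [e1, e2, e3] at h8)
    rw [← hX] at h9
    rw [add_tsub_cancel_right, h9, Int.cast_natCast]
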